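/- **Proposition 6.1.** Let $X$ be a complex Banach space and let $T=(T_1,\dots,T_n)$ be a tuple of commuting bounded operators on $X$. Set $\hat T\colon X^n\to X$, $\hat T(x_1,\dots,x_n)=\sum_i T_ix_i$, and $\tilde T\colon X\to X^n$, $\tilde T(x)=(T_1x,\dots,T_nx)$. For $z\in\mathbb C^n$ write $T-z=(T_1-z_1I,\dots,T_n-z_nI)$. Define the following subsets of $\mathbb C^n$: - the defect spectrum $\sigma_\delta(T)$, the set of all $z$ such that $R(T_1-z_1)+\dots+R(T_n-z_n)\neq X$; - the approximate point spectrum $\sigma_\pi(T)$, the set of all $z$ such that $\widetilde{T-z}$ has nonzero kernel or non-closed range; - the split defect spectrum $sp_\delta(T)$, the union of $\sigma_\delta(T)$ and the set of all $z$ such that the kernel of $\widehat{T-z}$ has no closed direct complement in $X^n$; - the split approximate point spectrum $sp_\pi(T)$, the union of $\sigma_\pi(T)$ and the set of all $z$ such that the range of $\widetilde{T-z}$ is not a closed subspace with a closed direct complement in $X^n$. Let $X_1,X_2$ be complex Banach spaces and let $J$ be an operator ideal between $X_2$ and $X_1$. That is, $J$ is a linear subspace of $L(X_2,X_1)$, complete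 with respect to a norm $\alpha$ on $J$, such that 1. for all $x_1\in X_1$ and $x_2'\in X_2'$, the rank one operator $x_1\otimes x_2'\colon x_2\mapsto\langle x_2,x_2'\rangle x_1$ belongs to $J$, and $\alpha(x_1\otimes x_2')=\|x_1\|\,\|x_2'\|$; 2. for all $A\in J$, $S\in L(X_1)$ and $T\in L(X_2)$, $SAT\in J$ and $\alpha(SAT)\le\|S\|\,\alpha(A)\,\|T\|$. Let $S=(S_1,\dots,S_n)$ and $T=(T_1,\dots,T_m)$ be tuples of commuting bounded operators on $X_1$ and $X_2$ respectively, and let $(L_S,R_T)=(L_{S_1},\dots,L_{S_n},R_{T_1},\dots,R_{T_m})$ be the $(n+m)$-tuple of operators on the Banach space $(J,\alpha)$ given by $L_{S_i}(A)=S_iA$ and $R_{T_j}(A)=AT_j$. Then, identifying $\mathbb C^n\times\mathbb C^m$ with $\mathbb C^{n+m}$, (i) $\sigma_\delta(S)\times\sigma_\pi(T)\subseteq\sigma_\delta(L_S,R_T)\subseteq sp_\delta(L_S,R_T)\subseteq sp_\delta(S)\times sp_\pi(T)$; (ii) $\sigma_\pi(S)\times\sigma_\delta(T)\subseteq\sigma_\pi(L_S,R_T)\subseteq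 sp_\pi(L_S,R_T)\subseteq sp_\pi(S)\times sp_\delta(T)$. If moreover $X_1$ and $X_2$ are Hilbert spaces, then all the inclusions in (i) and (ii) are equalities. -/

import Mathlib

noncomputable section

namespace JointSpectra

section Spectra

variable {X : Type*} [NormedAddCommGroup X] [NormedSpace ℂ X] {n : ℕ}

/-- The translated tuple `T - z = (T₁ - z₁ I, …, Tₙ - zₙ I)`. -/
def translate (T : Fin n → X →L[ℂ] X) (z : Fin n → ℂ) : Fin n → X →L[ℂ] X :=
  fun i => T i - z i • ContinuousLinearMap.id ℂ X

/-- The operator `X ^ n → X`, `(x₁, …, xₙ) ↦ T₁ x₁ + ⋯ + Tₙ xₙ`. -/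
def hat (T : Fin n → X →L[ℂ] X) : (Fin n → X) →L[ℂ] X :=
  ∑ i, (T i).comp (ContinuousLinearMap.proj i)

/-- The operator `X → X ^ n`, `x ↦ (T₁ x, …, Tₙ x)`. -/
def tilde (T : Fin n → X →L[ℂ] X) : X →L[ℂ] (Fin n → X) :=
  ContinuousLinearMap.pi T

/-- The sum of ranges `R(T₁) + ⋯ + R(Tₙ)`. -/
def sumRange (T : Fin n → X →L[ℂ] X) : Submodule ℂ X :=
  ⨆ i, (T i : X →ₗ[ℂ] X).range

/-- The defect spectrum: `codim (R(T₁ - z₁) + ⋯ + R(Tₙ - zₙ)) ≠ 0`. -/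
def defectSpectrum (T : Fin n → X →L[ℂ] X) : Set (Fin n → ℂ) :=
  {z | Module.rank ℂ (X ⧸ sumRange (translate T z)) ≠ 0}

/-- The approximate point spectrum: the map `x ↦ ((Tᵢ - zᵢ) x)ᵢ` has a nonzero kernel or
a range which is not closed. -/
def approxPointSpectrum (T : Fin n → X →L[ℂ] X) : Set (Fin n → ℂ) :=
  {z | (tilde (translate T z) : X →ₗ[ℂ] (Fin n → X)).ker ≠ ⊥ ∨
    ¬ IsClosed (((tilde (translate T z) : X →ₗ[ℂ] (Fin n → X)).range : Set (Fin n → X)))}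

/-- The split defect spectrum: the defect spectrum, together with the points for which the kernel
of the map `X ^ n → X` has no (topological) direct complement in `X ^ n`. -/
def splitDefectSpectrum (T : Fin n → X →L[ℂ] X) : Set (Fin n → ℂ) :=
  defectSpectrum T ∪
    {z | ¬ (hat (translate T z) : (Fin n → X) →ₗ[ℂ] X).ker.ClosedComplemented}

/-- The split approximate point spectrum: the approximate point spectrum, together with the points
for which the range of the map `X → X ^ n` has no (topological) direct complement in `X ^ n`. -/
def splitApproxPointSpectrum (T : Fin n → X →L[ℂ] X) : Set (Fin n → ℂ) :=
  approxPointSpectrum T ∪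
    {z | ¬ (tilde (translate T z) : X →ₗ[ℂ] (Fin n → X)).range.ClosedComplemented}

end Spectra

/-- The product of `A ⊆ ℂ ^ n` and `B ⊆ ℂ ^ m`, as a subset of `ℂ ^ (n + m)`. -/
def prodSet {n m : ℕ} (A : Set (Fin n → ℂ)) (B : Set (Fin m → ℂ)) : Set (Fin (n + m) → ℂ) :=
  Set.image2 Fin.append A B

/-- The norm of `X` is induced by an inner product (so that `X`, when complete, is a Hilbert
space). -/
def IsHilbert (X : Type*) [NormedAddCommGroup X] [inst : NormedSpace ℂ X] : Prop :=
  ∃ I : InnerProductSpace ℂ X, I.toNormedSpace = inst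

/-- An operator ideal between `X₂` and `X₁`: a linear subspace of `L(X₂, X₁)` with its own
norm `α` such that rank one operators `x ⊗ u : y ↦ u(y) x` lie in it with `α (x ⊗ u) = ‖x‖ ‖u‖`,
and which is stable under composition with bounded operators on both sides,
with `α (S A T) ≤ ‖S‖ α(A) ‖T‖`. Completeness of the norm `α` is the separate
assumption `CompleteSpace J.Space`. -/
structure OperatorIdeal (X₂ X₁ : Type*) [NormedAddCommGroup X₂] [NormedSpace ℂ X₂]
    [NormedAddCommGroup X₁] [NormedSpace ℂ X₁] where
  carrier : Submodule ℂ (X₂ →L[ℂ] X₁)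
  α : carrier → ℝ
  α_nonneg : ∀ A, 0 ≤ α A
  α_eq_zero_iff : ∀ A, α A = 0 ↔ A = 0
  α_smul : ∀ (c : ℂ) (A), α (c • A) = ‖c‖ * α A
  α_add_le : ∀ A B, α (A + B) ≤ α A + α B
  rankOne_mem : ∀ (x : X₁) (u : X₂ →L[ℂ] ℂ), u.smulRight x ∈ carrier
  α_rankOne : ∀ (x : X₁) (u : X₂ →L[ℂ] ℂ), α ⟨u.smulRight x, rankOne_mem x u⟩ = ‖x‖ * ‖u‖
  comp_mem : ∀ (S : X₁ →L[ℂ] X₁) (A : carrier) (T : X₂ →L[ℂ] X₂),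
    S ∘L (A : X₂ →L[ℂ] X₁) ∘L T ∈ carrier
  α_comp_le : ∀ (S : X₁ →L[ℂ] X₁) (A : carrier) (T : X₂ →L[ℂ] X₂),
    α ⟨S ∘L (A : X₂ →L[ℂ] X₁) ∘L T, comp_mem S A T⟩ ≤ ‖S‖ * α A * ‖T‖

namespace OperatorIdeal

variable {X₂ X₁ : Type*} [NormedAddCommGroup X₂] [NormedSpace ℂ X₂]
  [NormedAddCommGroup X₁] [NormedSpace ℂ X₁]

/-- The operator ideal as a normed space for the norm `α` (not for the operator norm). -/
def Space (J : OperatorIdeal X₂ X₁) : Type _ := J.carrier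

instance (J : OperatorIdeal X₂ X₁) : AddCommGroup J.Space :=
  inferInstanceAs (AddCommGroup J.carrier)

instance (J : OperatorIdeal X₂ X₁) : Module ℂ J.Space :=
  inferInstanceAs (Module ℂ J.carrier)

instance (J : OperatorIdeal X₂ X₁) : Norm J.Space := ⟨J.α⟩

theorem normCore (J : OperatorIdeal X₂ X₁) : NormedSpace.Core ℂ J.Space where
  norm_nonneg := J.α_nonneg
  norm_smul := J.α_smul
  norm_triangle := J.α_add_le
  norm_eq_zero_iff := J.α_eq_zero_iff

instance (J : OperatorIdeal X₂ X₁) : NormedAddCommGroup J.Space :=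
  NormedAddCommGroup.ofCore J.normCore

instance (J : OperatorIdeal X₂ X₁) : NormedSpace ℂ J.Space :=
  NormedSpace.ofCore J.normCore

/-- The element of `L(X₂, X₁)` underlying an element of the ideal. -/
def toOp (J : OperatorIdeal X₂ X₁) (A : J.Space) : X₂ →L[ℂ] X₁ := A.1

theorem left_mem (J : OperatorIdeal X₂ X₁) (S : X₁ →L[ℂ] X₁) (A : J.carrier) :
    S ∘L (A : X₂ →L[ℂ] X₁) ∈ J.carrier := by
  simpa using J.comp_mem S A (ContinuousLinearMap.id ℂ X₂)

theorem right_mem (J : OperatorIdeal X₂ X₁) (T : X₂ →L[ℂ] X₂) (A : J.carrier) :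
    (A : X₂ →L[ℂ] X₁) ∘L T ∈ J.carrier := by
  simpa using J.comp_mem (ContinuousLinearMap.id ℂ X₁) A T

theorem α_left_le (J : OperatorIdeal X₂ X₁) (S : X₁ →L[ℂ] X₁) (A : J.carrier) :
    J.α ⟨S ∘L (A : X₂ →L[ℂ] X₁), J.left_mem S A⟩ ≤ ‖S‖ * J.α A :=
  (J.α_comp_le S A (ContinuousLinearMap.id ℂ X₂)).trans
    (mul_le_of_le_one_right (mul_nonneg (norm_nonneg _) (J.α_nonneg _))
      ContinuousLinearMap.norm_id_le)

theorem α_right_le (J : OperatorIdeal X₂ X₁) (T : X₂ →L[ℂ] X₂) (A : J.carrier) :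
    J.α ⟨(A : X₂ →L[ℂ] X₁) ∘L T, J.right_mem T A⟩ ≤ ‖T‖ * J.α A := by
  refine (J.α_comp_le (ContinuousLinearMap.id ℂ X₁) A T).trans ?_
  rw [mul_comm]
  exact mul_le_mul_of_nonneg_left
    (mul_le_of_le_one_left (J.α_nonneg _) ContinuousLinearMap.norm_id_le) (norm_nonneg _)

/-- Left multiplication `A ↦ S A` as a bounded operator on the ideal. -/
def leftMul (J : OperatorIdeal X₂ X₁) (S : X₁ →L[ℂ] X₁) : J.Space →L[ℂ] J.Space :=
  LinearMap.mkContinuous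
    { toFun := fun A => (⟨S ∘L J.toOp A, J.left_mem S A⟩ : J.carrier)
      map_add' := fun A B => Subtype.ext (ContinuousLinearMap.comp_add S (J.toOp A) (J.toOp B))
      map_smul' := fun c A => Subtype.ext (ContinuousLinearMap.comp_smul S c (J.toOp A)) }
    ‖S‖ (J.α_left_le S)

/-- Right multiplication `A ↦ A T` as a bounded operator on the ideal. -/
def rightMul (J : OperatorIdeal X₂ X₁) (T : X₂ →L[ℂ] X₂) : J.Space →L[ℂ] J.Space :=
  LinearMap.mkContinuous
    { toFun := fun A => (⟨J.toOp A ∘L T, J.right_mem T A⟩ : J.carrier)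
      map_add' := fun A B => Subtype.ext (ContinuousLinearMap.add_comp (J.toOp A) (J.toOp B) T)
      map_smul' := fun c A => Subtype.ext (ContinuousLinearMap.smul_comp c (J.toOp A) T) }
    ‖T‖ (J.α_right_le T)

/-- The `(n + m)`-tuple `(L_{S₁}, …, L_{Sₙ}, R_{T₁}, …, R_{Tₘ})` of multiplications on the ideal. -/
def mulTuple (J : OperatorIdeal X₂ X₁) {n m : ℕ} (S : Fin n → X₁ →L[ℂ] X₁)
    (T : Fin m → X₂ →L[ℂ] X₂) : Fin (n + m) → J.Space →L[ℂ] J.Space :=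
  Fin.append (fun i => J.leftMul (S i)) (fun j => J.rightMul (T j))

end OperatorIdeal

end JointSpectra

end

/-! Each spectrum is the failure set of one property of an operator: `hat` is surjective (defect) or
has a continuous right inverse (split defect); `tilde` is bounded below (approximate point) or has a
continuous left inverse (split approximate point).

The upper inclusions are algebraic: a one-sided inverse for `S` or for `T`, used as a left or right
multiplier, gives one for the multiplication tuple. A right factor reverses composition, so `T`
enters with `hat` and `tilde` exchanged.

The lower inclusions test on rank one operators. A point of the approximate point spectrum gives
approximate joint kernel vectors; a point of the defect spectrum gives, by Hahn-Banach, approximate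
joint kernel functionals. In (ii) their rank one product is an approximate kernel element. In (i)
the pair acts as an almost annihilating functional `A ↦ φ (A x)`, which is bounded because `α`
dominates the operator norm.

For Hilbert spaces `X₁` and `X₂` the two ends of each chain coincide, so the chain collapses without
any Hilbert structure on the ideal. -/

noncomputable section

namespace JointSpectra

open Filter Topology

/-! ### Surjectivity, lower bounds and one-sided inverses -/

section BanachSpaces

variable {E F : Type*} [NormedAddCommGroup E] [NormedSpace ℂ E]
  [NormedAddCommGroup F] [NormedSpace ℂ F]

/-- If the dual map of `f` is bounded below, then every vector has an approximate preimage under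
`f`, with control of its norm. -/
theorem exists_approx_preimage_of_dual_bound (f : E →L[ℂ] F) {c : ℝ} (hc : 0 < c)
    (h : ∀ φ : F →L[ℂ] ℂ, c * ‖φ‖ ≤ ‖φ.comp f‖) (y : F) :
    ∃ x, ‖y - f x‖ ≤ 1 / 2 * ‖y‖ ∧ ‖x‖ ≤ c⁻¹ * ‖y‖ := by
  rcases eq_or_ne y 0 with rfl | hy
  · exact ⟨0, by simp⟩
  have hy' : 0 < ‖y‖ := norm_pos_iff.2 hy
  set r := c⁻¹ * ‖y‖ with hr
  have hr0 : 0 < r := by positivity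
  have hmem : y ∈ closure (f '' Metric.closedBall 0 r) := by
    -- Separating `y` from this convex set gives `‖φ.comp f‖ * r ≤ u < re (φ y)`. The radius `r` is
    -- chosen so that the dual bound turns the left side into at least `‖φ‖ * ‖y‖`.
    by_contra hny
    have hconv : Convex ℝ (closure (f '' Metric.closedBall 0 r)) :=
      ((convex_closedBall (0 : E) r).linear_image ((f : E →ₗ[ℂ] F).restrictScalars ℝ)).closure
    obtain ⟨φ, u, hu, huy⟩ :=
      RCLike.geometric_hahn_banach_closed_point (𝕜 := ℂ) hconv isClosed_closure hny
    have hball : ∀ x, ‖x‖ ≤ r → ‖φ (f x)‖ ≤ u := by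
      intro x hx
      obtain ⟨ω, hω, hωx⟩ := RCLike.exists_norm_eq_mul_self (K := ℂ) (φ (f x))
      have hmem : f (ω • x) ∈ closure (f '' Metric.closedBall 0 r) :=
        subset_closure ⟨ω • x, by simpa [norm_smul, hω] using hx, rfl⟩
      have := (hu _ hmem).le
      rw [map_smul, map_smul, smul_eq_mul, ← hωx, RCLike.ofReal_re] at this
      exact this
    have hcomp : ‖φ.comp f‖ ≤ u / r :=
      ContinuousLinearMap.opNorm_bound_of_ball_bound hr0 u _ fun x hx =>
        hball x (mem_closedBall_zero_iff.1 hx)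
    have h1 : c * ‖φ‖ * r ≤ u := by
      have := (h φ).trans hcomp
      rwa [le_div_iff₀ hr0] at this
    have h2 : c * ‖φ‖ * r = ‖φ‖ * ‖y‖ := by rw [hr]; field_simp
    have h3 : RCLike.re (φ y) ≤ ‖φ‖ * ‖y‖ := (RCLike.re_le_norm _).trans (φ.le_opNorm y)
    linarith
  obtain ⟨_, ⟨x, hx, rfl⟩, hxy⟩ := Metric.mem_closure_iff.1 hmem (1 / 2 * ‖y‖) (by positivity)
  exact ⟨x, by simpa [dist_eq_norm] using hxy.le, by simpa using hx⟩

/-- A bounded operator on a Banach space whose dual map is bounded below is surjective. -/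
theorem surjective_of_dual_bound [CompleteSpace E] (f : E →L[ℂ] F) {c : ℝ} (hc : 0 < c)
    (h : ∀ φ : F →L[ℂ] ℂ, c * ‖φ‖ ≤ ‖φ.comp f‖) : Function.Surjective f := by
  choose g hg hgn using exists_approx_preimage_of_dual_bound f hc h
  intro y
  -- Successive approximation: the residuals `r k` at least halve in norm at each step, so the
  -- corrections sum to a preimage.
  let r : ℕ → F := fun k => (fun y => y - f (g y))^[k] y
  have hr : ∀ k, r (k + 1) = r k - f (g (r k)) := fun k => by
    simp only [r, Function.iterate_succ_apply']
  have hrn : ∀ k, ‖r k‖ ≤ (1 / 2) ^ k * ‖y‖ := by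
    intro k
    induction k with
    | zero => simp [r]
    | succ k ih =>
      rw [hr, pow_succ']
      linarith [hg (r k)]
  have hsum : Summable fun k => g (r k) := by
    refine Summable.of_norm_bounded (g := fun k => c⁻¹ * ((1 / 2) ^ k * ‖y‖))
      ((summable_geometric_two.mul_right _).mul_left _) fun k => (hgn _).trans ?_
    gcongr
    exact hrn k
  refine ⟨∑' k, g (r k), ?_⟩
  have hpart : ∀ k, f (∑ i ∈ Finset.range k, g (r i)) = y - r k := by
    intro k
    induction k with
    | zero => simp [r]
    | succ k ih => rw [Finset.sum_range_succ, map_add, ih, hr]; abel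
  have h0 : Tendsto r atTop (𝓝 0) := by
    refine squeeze_zero_norm hrn ?_
    simpa using (tendsto_pow_atTop_nhds_zero_of_lt_one (r := (1 / 2 : ℝ))
      (by norm_num) (by norm_num)).mul_const ‖y‖
  have h1 := (f.continuous.tendsto _).comp hsum.hasSum.tendsto_sum_nat
  have h2 : Tendsto (fun k => y - r k) atTop (𝓝 (y - 0)) := tendsto_const_nhds.sub h0
  rw [sub_zero] at h2
  exact tendsto_nhds_unique (h1.congr hpart) h2

/-- An operator between Banach spaces is surjective with complemented kernel iff it has a
continuous right inverse. -/
theorem hasRightInverse_iff [CompleteSpace E] [CompleteSpace F] (f : E →L[ℂ] F) :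
    f.HasRightInverse ↔ Function.Surjective f ∧ (f : E →ₗ[ℂ] F).ker.ClosedComplemented := by
  constructor
  · rintro ⟨g, hg⟩
    exact ⟨hg.surjective, f.closedComplemented_ker_of_rightInverse g hg⟩
  · rintro ⟨hf, p, hp⟩
    obtain ⟨g, hg⟩ := (f : E →ₗ[ℂ] F).exists_rightInverse_of_surjective
      (LinearMap.range_eq_top.2 hf)
    have hfg : ∀ y, f (g y) = y := fun y => LinearMap.congr_fun hg y
    -- `q` kills the kernel of `f`, so `q ∘ g` does not depend on the choice of the algebraic
    -- section `g`.
    let q : E →L[ℂ] E := ContinuousLinearMap.id ℂ E - (Submodule.subtypeL _).comp p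
    have hq : ∀ x, f (q x) = f x := by
      intro x
      have : f (p x : E) = 0 := (p x).2
      simp [q, this]
    have hqf : ∀ x, q (g (f x)) = q x := by
      intro x
      have hmem : g (f x) - x ∈ (f : E →ₗ[ℂ] F).ker := by simp [hfg]
      have h1 := hp ⟨_, hmem⟩
      have h2 : q (g (f x) - x) = 0 := by
        simp only [q, _root_.sub_apply, ContinuousLinearMap.comp_apply,
          ContinuousLinearMap.id_apply, Submodule.subtypeL_apply]
        rw [h1, sub_self]
      rwa [map_sub, sub_eq_zero] at h2
    refine ⟨⟨(q : E →ₗ[ℂ] E).comp g, ?_⟩, fun y => ?_⟩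
    -- By the open mapping theorem, continuity may be tested after composing with `f`, where `q ∘ g
    -- ∘ f = q`.
    · refine (f.isQuotientMap hf).continuous_iff.2 ?_
      exact q.continuous.congr fun x => (hqf x).symm
    · exact (hq _).trans (hfg y)

/-- An operator between Banach spaces is injective with closed range iff it is bounded below. -/
theorem boundedBelow_iff [CompleteSpace E] [CompleteSpace F] (f : E →L[ℂ] F) :
    ((f : E →ₗ[ℂ] F).ker = ⊥ ∧ IsClosed ((f : E →ₗ[ℂ] F).range : Set F)) ↔
      ∃ c > 0, ∀ x, c * ‖x‖ ≤ ‖f x‖ := by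
  constructor
  · rintro ⟨h1, h2⟩
    obtain ⟨K, hK⟩ := f.antilipschitz_of_injective_of_isClosed_range
      (LinearMap.ker_eq_bot.1 h1) (by simpa using! h2)
    refine ⟨((K : ℝ) + 1)⁻¹, by positivity, fun x => ?_⟩
    rw [inv_mul_le_iff₀ (by positivity)]
    have := hK.le_mul_dist x 0
    simp only [map_zero, dist_zero_right] at this
    nlinarith [norm_nonneg (f x)]
  · rintro ⟨c, hc, h⟩
    have hK : AntilipschitzWith (Real.toNNReal c⁻¹) f :=
      AddMonoidHomClass.antilipschitz_of_bound f fun x => by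
        rw [Real.coe_toNNReal _ (by positivity), le_inv_mul_iff₀ hc]
        exact h x
    exact ⟨LinearMap.ker_eq_bot.2 hK.injective, hK.isClosed_range f.uniformContinuous⟩

theorem hasLeftInverse_iff [CompleteSpace E] [CompleteSpace F] (f : E →L[ℂ] F) :
    f.HasLeftInverse ↔ ((f : E →ₗ[ℂ] F).ker = ⊥ ∧ IsClosed ((f : E →ₗ[ℂ] F).range : Set F)) ∧
      (f : E →ₗ[ℂ] F).range.ClosedComplemented := by
  constructor
  · intro h
    exact ⟨⟨LinearMap.ker_eq_bot.2 h.injective, h.isClosed_range⟩, h.closedComplemented_range⟩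
  · rintro ⟨⟨h1, h2⟩, h3⟩
    exact .of_injective_of_isClosed_range_of_closedComplement_range
      (LinearMap.ker_eq_bot.1 h1) h2 h3

end BanachSpaces

/-! ### The spectra in terms of operators -/

section Spectra

variable {X : Type*} [NormedAddCommGroup X] [NormedSpace ℂ X] {n : ℕ}

@[simp] theorem hat_apply (T : Fin n → X →L[ℂ] X) (x : Fin n → X) :
    hat T x = ∑ i, T i (x i) := by
  simp [hat]

@[simp] theorem tilde_apply (T : Fin n → X →L[ℂ] X) (x : X) (i : Fin n) :
    tilde T x i = T i x := rfl

theorem sumRange_eq_range_hat (T : Fin n → X →L[ℂ] X) :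
    sumRange T = (hat T : (Fin n → X) →ₗ[ℂ] X).range := by
  refine le_antisymm (iSup_le fun i => ?_) ?_
  · rintro _ ⟨x, rfl⟩
    refine ⟨Pi.single i x, ?_⟩
    simp only [ContinuousLinearMap.coe_coe, hat_apply]
    rw [Finset.sum_eq_single i (by intro j _ hj; simp [hj]) (by simp)]
    simp
  · rintro _ ⟨x, rfl⟩
    simp only [ContinuousLinearMap.coe_coe, hat_apply]
    exact Submodule.sum_mem _ fun i _ =>
      Submodule.mem_iSup_of_mem i ⟨x i, rfl⟩

theorem notMem_defectSpectrum_iff (T : Fin n → X →L[ℂ] X) (z : Fin n → ℂ) :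
    z ∉ defectSpectrum T ↔ Function.Surjective (hat (translate T z)) := by
  rw [defectSpectrum, Set.mem_ofPred_eq, not_not, rank_zero_iff,
    Submodule.Quotient.subsingleton_iff, sumRange_eq_range_hat, LinearMap.range_eq_top]
  rfl

theorem notMem_splitDefectSpectrum_iff [CompleteSpace X] (T : Fin n → X →L[ℂ] X)
    (z : Fin n → ℂ) :
    z ∉ splitDefectSpectrum T ↔ (hat (translate T z)).HasRightInverse := by
  rw [hasRightInverse_iff, splitDefectSpectrum, Set.mem_union, not_or,
    notMem_defectSpectrum_iff, Set.mem_ofPred_eq, not_not]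

theorem notMem_approxPointSpectrum_iff [CompleteSpace X] (T : Fin n → X →L[ℂ] X)
    (z : Fin n → ℂ) :
    z ∉ approxPointSpectrum T ↔ ∃ c > 0, ∀ x, c * ‖x‖ ≤ ‖tilde (translate T z) x‖ := by
  rw [← boundedBelow_iff, approxPointSpectrum, Set.mem_ofPred_eq, not_or, not_not, not_not]

theorem notMem_splitApproxPointSpectrum_iff [CompleteSpace X] (T : Fin n → X →L[ℂ] X)
    (z : Fin n → ℂ) :
    z ∉ splitApproxPointSpectrum T ↔ (tilde (translate T z)).HasLeftInverse := by
  rw [hasLeftInverse_iff, splitApproxPointSpectrum, Set.mem_union, not_or, approxPointSpectrum,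
    Set.mem_ofPred_eq, Set.mem_ofPred_eq, not_or, not_not, not_not, not_not]

/-- At a point of the approximate point spectrum there are approximate joint kernel vectors. -/
theorem exists_norm_tilde_lt [CompleteSpace X] {T : Fin n → X →L[ℂ] X} {z : Fin n → ℂ}
    (hz : z ∈ approxPointSpectrum T) {ε : ℝ} (hε : 0 < ε) :
    ∃ x, ‖tilde (translate T z) x‖ < ε * ‖x‖ := by
  by_contra! h
  exact (notMem_approxPointSpectrum_iff T z).2 ⟨ε, hε, h⟩ hz

/-- At a point of the defect spectrum there are approximate joint kernel functionals. -/
theorem exists_norm_comp_hat_lt [CompleteSpace X] {T : Fin n → X →L[ℂ] X} {z : Fin n → ℂ}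
    (hz : z ∈ defectSpectrum T) {ε : ℝ} (hε : 0 < ε) :
    ∃ φ : X →L[ℂ] ℂ, ‖φ.comp (hat (translate T z))‖ < ε * ‖φ‖ := by
  by_contra! h
  exact (notMem_defectSpectrum_iff T z).2 (surjective_of_dual_bound _ hε h) hz

theorem norm_comp_le_norm_comp_hat (T : Fin n → X →L[ℂ] X) (φ : X →L[ℂ] ℂ) (i : Fin n) :
    ‖φ.comp (T i)‖ ≤ ‖φ.comp (hat T)‖ := by
  refine ContinuousLinearMap.opNorm_le_bound _ (norm_nonneg _) fun x => ?_
  have h := (φ.comp (hat T)).le_opNorm (Pi.single i x)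
  have h1 : hat T (Pi.single i x) = T i x := by
    rw [hat_apply, Finset.sum_eq_single i (by intro j _ hj; simp [hj]) (by simp)]
    simp
  rwa [ContinuousLinearMap.comp_apply, h1, Pi.norm_single] at h

/-- In a finite power of a Hilbert space every closed subspace is complemented. -/
theorem IsHilbert.closedComplemented [CompleteSpace X] (hX : IsHilbert X)
    {p : Submodule ℂ (Fin n → X)} (hp : IsClosed (p : Set (Fin n → X))) :
    p.ClosedComplemented := by
  obtain ⟨I, rfl⟩ := hX
  -- The sup norm on the power is not Hilbertian; the equivalent ℓ² norm supplies the orthogonal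
  -- projection.
  let e : PiLp 2 (fun _ : Fin n => X) ≃L[ℂ] (Fin n → X) :=
    PiLp.continuousLinearEquiv 2 ℂ (fun _ : Fin n => X)
  let q : Submodule ℂ (PiLp 2 (fun _ : Fin n => X)) := p.comap (e : _ →ₗ[ℂ] (Fin n → X))
  have hq : IsClosed (q : Set (PiLp 2 (fun _ : Fin n => X))) := hp.preimage e.continuous
  have : CompleteSpace q := hq.completeSpace_coe
  let P := q.orthogonalProjectionOnto
  refine ⟨(((e : _ →L[ℂ] (Fin n → X)).comp (q.subtypeL.comp P)).comp
    (e.symm : (Fin n → X) →L[ℂ] _)).codRestrict p fun x => (P (e.symm x)).2, fun x => ?_⟩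
  have hx : e.symm (x : Fin n → X) ∈ q := by simp [q]
  refine Subtype.ext ?_
  have h1 : (P (e.symm x) : PiLp 2 (fun _ : Fin n => X)) = e.symm x :=
    Submodule.starProjection_eq_self_iff.2 hx
  exact (congrArg e h1).trans (e.apply_symm_apply _)

theorem IsHilbert.splitDefectSpectrum_eq [CompleteSpace X] (hX : IsHilbert X)
    (T : Fin n → X →L[ℂ] X) : splitDefectSpectrum T = defectSpectrum T :=
  Set.union_eq_self_of_subset_right fun _ hz =>
    absurd (hX.closedComplemented (ContinuousLinearMap.isClosed_ker _)) hz

theorem IsHilbert.splitApproxPointSpectrum_eq [CompleteSpace X] (hX : IsHilbert X)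
    (T : Fin n → X →L[ℂ] X) : splitApproxPointSpectrum T = approxPointSpectrum T := by
  refine Set.union_eq_self_of_subset_right fun z hz => Or.inr fun hc => ?_
  exact hz (hX.closedComplemented hc)

end Spectra

/-! ### Multiplication operators on the ideal -/

namespace OperatorIdeal

variable {X₁ X₂ : Type*} [NormedAddCommGroup X₁] [NormedSpace ℂ X₁]
  [NormedAddCommGroup X₂] [NormedSpace ℂ X₂] (J : OperatorIdeal X₂ X₁) {n m : ℕ}

@[simp] theorem toOp_leftMul (S : X₁ →L[ℂ] X₁) (A : J.Space) :
    J.toOp (J.leftMul S A) = S ∘L J.toOp A := rfl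

@[simp] theorem toOp_rightMul (T : X₂ →L[ℂ] X₂) (A : J.Space) :
    J.toOp (J.rightMul T A) = J.toOp A ∘L T := rfl

theorem toOp_injective : Function.Injective J.toOp := Subtype.coe_injective

@[simp] theorem toOp_add (A B : J.Space) : J.toOp (A + B) = J.toOp A + J.toOp B := rfl

@[simp] theorem toOp_sub (A B : J.Space) : J.toOp (A - B) = J.toOp A - J.toOp B := rfl

@[simp] theorem toOp_smul (c : ℂ) (A : J.Space) : J.toOp (c • A) = c • J.toOp A := rfl

@[simp] theorem toOp_sum {ι : Type*} (s : Finset ι) (A : ι → J.Space) :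
    J.toOp (∑ i ∈ s, A i) = ∑ i ∈ s, J.toOp (A i) :=
  map_sum (AddMonoidHom.mk' J.toOp J.toOp_add) A s

/-- The rank one operator `y ↦ u y • x` as an element of the ideal. -/
def rankOne (x : X₁) (u : X₂ →L[ℂ] ℂ) : J.Space :=
  (⟨u.smulRight x, J.rankOne_mem x u⟩ : J.carrier)

@[simp] theorem toOp_rankOne (x : X₁) (u : X₂ →L[ℂ] ℂ) :
    J.toOp (J.rankOne x u) = u.smulRight x := rfl

theorem norm_rankOne (x : X₁) (u : X₂ →L[ℂ] ℂ) : ‖J.rankOne x u‖ = ‖x‖ * ‖u‖ :=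
  J.α_rankOne x u

theorem leftMul_rankOne (S : X₁ →L[ℂ] X₁) (x : X₁) (u : X₂ →L[ℂ] ℂ) :
    J.leftMul S (J.rankOne x u) = J.rankOne (S x) u :=
  J.toOp_injective <| by ext; simp

theorem rightMul_rankOne (T : X₂ →L[ℂ] X₂) (x : X₁) (u : X₂ →L[ℂ] ℂ) :
    J.rightMul T (J.rankOne x u) = J.rankOne x (u.comp T) :=
  J.toOp_injective <| by ext; simp

/-- The ideal norm dominates the operator norm. -/
theorem norm_toOp_apply_le (A : J.Space) (x : X₂) : ‖J.toOp A x‖ ≤ ‖A‖ * ‖x‖ := by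
  rcases eq_or_ne x 0 with rfl | hx
  · simp
  rcases eq_or_ne (J.toOp A x) 0 with hy | hy
  · rw [hy, norm_zero]
    positivity
  obtain ⟨u, hu, -⟩ := exists_dual_vector ℂ x (norm_ne_zero_iff.2 hx)
  obtain ⟨φ, hφ, hφy⟩ := exists_dual_vector ℂ (J.toOp A x) (norm_ne_zero_iff.2 hy)
  set y := J.toOp A x with hydef
  -- Sandwiching `A` between rank one operators leaves a rank one operator of known norm, giving
  -- `‖y‖ * ‖y‖ ≤ ‖y‖ * (‖x‖ * ‖A‖)`.
  have hmul : J.leftMul (φ.smulRight y) (J.rightMul (u.smulRight x) A) =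
      (‖y‖ : ℂ) • J.rankOne y u := by
    refine J.toOp_injective ?_
    ext v
    simp only [toOp_leftMul, toOp_rightMul, toOp_smul, toOp_rankOne,
      ContinuousLinearMap.comp_apply, ContinuousLinearMap.smulRight_apply, map_smul,
      _root_.smul_apply, ← hydef, hφy]
    rw [smul_comm]
    rfl
  have hle : ‖J.leftMul (φ.smulRight y) (J.rightMul (u.smulRight x) A)‖ ≤
      ‖φ.smulRight y‖ * (‖u.smulRight x‖ * ‖A‖) :=
    (J.α_left_le _ _).trans (mul_le_mul_of_nonneg_left (J.α_right_le _ _) (norm_nonneg _))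
  rw [hmul, norm_smul, norm_rankOne, ContinuousLinearMap.norm_smulRight_apply,
    ContinuousLinearMap.norm_smulRight_apply, hu, hφ, one_mul, one_mul, mul_one,
    Complex.norm_real, norm_norm] at hle
  have hy0 : 0 < ‖y‖ := norm_pos_iff.2 hy
  rw [mul_comm ‖A‖]
  exact le_of_mul_le_mul_left hle hy0

theorem translate_mulTuple (S : Fin n → X₁ →L[ℂ] X₁) (T : Fin m → X₂ →L[ℂ] X₂)
    (z : Fin n → ℂ) (w : Fin m → ℂ) :
    translate (J.mulTuple S T) (Fin.append z w) =
      J.mulTuple (translate S z) (translate T w) := by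
  funext k
  refine ContinuousLinearMap.ext fun A => J.toOp_injective ?_
  refine Fin.addCases (fun i => ?_) (fun j => ?_) k <;>
  · ext
    simp [translate, mulTuple]

theorem hat_mulTuple (S : Fin n → X₁ →L[ℂ] X₁) (T : Fin m → X₂ →L[ℂ] X₂)
    (A : Fin (n + m) → J.Space) :
    J.toOp (hat (J.mulTuple S T) A) =
      ∑ i, S i ∘L J.toOp (A (Fin.castAdd m i)) + ∑ j, J.toOp (A (Fin.natAdd n j)) ∘L T j := by
  simp [Fin.sum_univ_add, mulTuple]

/-- With `gᵢ` the components of the inverse, `A ↦ (g₁ A, …, gₙ A, 0, …, 0)` works, as `∑ Sᵢ gᵢ = 1`.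
-/
theorem hasRightInverse_hat_mulTuple_of_left (S : Fin n → X₁ →L[ℂ] X₁)
    (T : Fin m → X₂ →L[ℂ] X₂) (h : (hat S).HasRightInverse) :
    (hat (J.mulTuple S T)).HasRightInverse := by
  obtain ⟨g, hg⟩ := h
  refine ⟨ContinuousLinearMap.pi (Fin.append
    (fun i => J.leftMul ((ContinuousLinearMap.proj i).comp g)) (fun _ => 0)), fun A => ?_⟩
  refine J.toOp_injective (ContinuousLinearMap.ext fun x => ?_)
  have h0 : J.toOp 0 = 0 := rfl
  have := hg (J.toOp A x)
  rw [hat_apply] at this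
  simpa [-hat_apply, hat_mulTuple, h0, _root_.sum_apply] using this

/-- Here `∑ gⱼ Tⱼ = 1`, so `A ↦ (0, …, 0, A g₁, …, A gₘ)` works. -/
theorem hasRightInverse_hat_mulTuple_of_right (S : Fin n → X₁ →L[ℂ] X₁)
    (T : Fin m → X₂ →L[ℂ] X₂) (h : (tilde T).HasLeftInverse) :
    (hat (J.mulTuple S T)).HasRightInverse := by
  obtain ⟨g, hg⟩ := h
  refine ⟨ContinuousLinearMap.pi (Fin.append (fun _ => 0)
    (fun j => J.rightMul (g.comp (ContinuousLinearMap.single ℂ (fun _ => X₂) j)))), fun A => ?_⟩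
  refine J.toOp_injective (ContinuousLinearMap.ext fun x => ?_)
  have h0 : J.toOp 0 = 0 := rfl
  have h1 : ∑ j, g (Pi.single j (T j x)) = x := by
    rw [← map_sum, Finset.univ_sum_single (fun j => T j x)]
    exact hg x
  have h2 := congrArg (J.toOp A) h1
  rw [map_sum] at h2
  simpa [-hat_apply, hat_mulTuple, h0, _root_.sum_apply] using h2

theorem hasLeftInverse_tilde_mulTuple_of_left (S : Fin n → X₁ →L[ℂ] X₁)
    (T : Fin m → X₂ →L[ℂ] X₂) (h : (tilde S).HasLeftInverse) :
    (tilde (J.mulTuple S T)).HasLeftInverse := by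
  obtain ⟨g, hg⟩ := h
  refine ⟨∑ i, (J.leftMul (g.comp (ContinuousLinearMap.single ℂ (fun _ => X₁) i))).comp
    (ContinuousLinearMap.proj (Fin.castAdd m i)), fun A => ?_⟩
  refine J.toOp_injective (ContinuousLinearMap.ext fun x => ?_)
  have h1 : ∑ i, g (Pi.single i (S i (J.toOp A x))) = J.toOp A x := by
    rw [← map_sum, Finset.univ_sum_single (fun i => S i (J.toOp A x))]
    exact hg _
  simpa [mulTuple, _root_.sum_apply] using h1

theorem hasLeftInverse_tilde_mulTuple_of_right (S : Fin n → X₁ →L[ℂ] X₁)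
    (T : Fin m → X₂ →L[ℂ] X₂) (h : (hat T).HasRightInverse) :
    (tilde (J.mulTuple S T)).HasLeftInverse := by
  obtain ⟨g, hg⟩ := h
  refine ⟨∑ j, (J.rightMul ((ContinuousLinearMap.proj j).comp g)).comp
    (ContinuousLinearMap.proj (Fin.natAdd n j)), fun A => ?_⟩
  refine J.toOp_injective (ContinuousLinearMap.ext fun x => ?_)
  have h1 := hg x
  rw [hat_apply] at h1
  have h2 := congrArg (J.toOp A) h1
  rw [map_sum] at h2
  simpa [mulTuple, _root_.sum_apply] using h2

theorem exists_append_eq (v : Fin (n + m) → ℂ) :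
    ∃ (z : Fin n → ℂ) (w : Fin m → ℂ), Fin.append z w = v :=
  ⟨_, _, Fin.append_castAdd_natAdd⟩

theorem splitDefectSpectrum_mulTuple_subset [CompleteSpace X₁] [CompleteSpace X₂]
    [CompleteSpace J.Space] (S : Fin n → X₁ →L[ℂ] X₁) (T : Fin m → X₂ →L[ℂ] X₂) :
    splitDefectSpectrum (J.mulTuple S T) ⊆
      prodSet (splitDefectSpectrum S) (splitApproxPointSpectrum T) := by
  intro v hv
  obtain ⟨z, w, rfl⟩ := exists_append_eq v
  by_contra hcon
  refine absurd hv ((notMem_splitDefectSpectrum_iff _ _).2 ?_)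
  rw [translate_mulTuple]
  by_cases hz : z ∈ splitDefectSpectrum S
  · refine J.hasRightInverse_hat_mulTuple_of_right _ _
      ((notMem_splitApproxPointSpectrum_iff T w).1 fun hw => hcon ⟨z, hz, w, hw, rfl⟩)
  · exact J.hasRightInverse_hat_mulTuple_of_left _ _ ((notMem_splitDefectSpectrum_iff S z).1 hz)

theorem splitApproxPointSpectrum_mulTuple_subset [CompleteSpace X₁] [CompleteSpace X₂]
    [CompleteSpace J.Space] (S : Fin n → X₁ →L[ℂ] X₁) (T : Fin m → X₂ →L[ℂ] X₂) :
    splitApproxPointSpectrum (J.mulTuple S T) ⊆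
      prodSet (splitApproxPointSpectrum S) (splitDefectSpectrum T) := by
  intro v hv
  obtain ⟨z, w, rfl⟩ := exists_append_eq v
  by_contra hcon
  refine absurd hv ((notMem_splitApproxPointSpectrum_iff _ _).2 ?_)
  rw [translate_mulTuple]
  by_cases hz : z ∈ splitApproxPointSpectrum S
  · refine J.hasLeftInverse_tilde_mulTuple_of_right _ _
      ((notMem_splitDefectSpectrum_iff T w).1 fun hw => hcon ⟨z, hz, w, hw, rfl⟩)
  · exact J.hasLeftInverse_tilde_mulTuple_of_left _ _
      ((notMem_splitApproxPointSpectrum_iff S z).1 hz)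

/-- Applying a functional `φ` and a vector `x` to an element in the range of `hat (L_S, R_T)`. -/
theorem norm_apply_hat_mulTuple_le (S : Fin n → X₁ →L[ℂ] X₁) (T : Fin m → X₂ →L[ℂ] X₂)
    (φ : X₁ →L[ℂ] ℂ) (x : X₂) (A : Fin (n + m) → J.Space) :
    ‖φ (J.toOp (hat (J.mulTuple S T) A) x)‖ ≤
      (n * (‖φ.comp (hat S)‖ * ‖x‖) + m * (‖φ‖ * ‖tilde T x‖)) * ‖A‖ := by
  have h1 : ‖∑ i, φ (S i (J.toOp (A (Fin.castAdd m i)) x))‖ ≤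
      n * (‖φ.comp (hat S)‖ * (‖A‖ * ‖x‖)) := by
    refine (norm_sum_le_of_le _ fun i _ => ?_).trans_eq
      (by rw [Finset.sum_const, Finset.card_univ, Fintype.card_fin, nsmul_eq_mul])
    refine ((φ.comp (S i)).le_opNorm _).trans ?_
    gcongr
    · exact norm_comp_le_norm_comp_hat S φ i
    · refine (J.norm_toOp_apply_le _ x).trans ?_
      gcongr
      exact norm_le_pi_norm A _
  have h2 : ‖∑ j, φ (J.toOp (A (Fin.natAdd n j)) (T j x))‖ ≤
      m * (‖φ‖ * (‖A‖ * ‖tilde T x‖)) := by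
    refine (norm_sum_le_of_le _ fun j _ => ?_).trans_eq
      (by rw [Finset.sum_const, Finset.card_univ, Fintype.card_fin, nsmul_eq_mul])
    refine (φ.le_opNorm _).trans ?_
    gcongr
    refine (J.norm_toOp_apply_le _ _).trans ?_
    gcongr
    · exact norm_le_pi_norm A _
    · exact norm_le_pi_norm (tilde T x) j
  have h3 : φ (J.toOp (hat (J.mulTuple S T) A) x) =
      ∑ i, φ (S i (J.toOp (A (Fin.castAdd m i)) x)) +
        ∑ j, φ (J.toOp (A (Fin.natAdd n j)) (T j x)) := by
    simp [-hat_apply, hat_mulTuple, _root_.sum_apply]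
  rw [h3]
  refine (norm_add_le _ _).trans ((add_le_add h1 h2).trans_eq ?_)
  ring

/-- If `hat` were surjective, a rank one operator on which `A ↦ φ (A x)` is large would have a
preimage of controlled norm, but this functional is small on the range. -/
theorem prodSet_subset_defectSpectrum_mulTuple [CompleteSpace X₁] [CompleteSpace X₂]
    [CompleteSpace J.Space] (S : Fin n → X₁ →L[ℂ] X₁) (T : Fin m → X₂ →L[ℂ] X₂) :
    prodSet (defectSpectrum S) (approxPointSpectrum T) ⊆ defectSpectrum (J.mulTuple S T) := by
  rintro _ ⟨z, hz, w, hw, rfl⟩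
  by_contra hcon
  rw [notMem_defectSpectrum_iff, translate_mulTuple] at hcon
  obtain ⟨C, hC, hpre⟩ := ContinuousLinearMap.exists_preimage_norm_le _ hcon
  -- The `1 / 2` matches the fraction of `‖φ‖ * ‖y‖` that `‖φ y‖` exceeds below; the `+ 1` covers `n
  -- + m = 0`.
  obtain ⟨ε, hε, hεC⟩ : ∃ ε > 0, (n + m) * ε * C < (1 / 2 : ℝ) := by
    refine ⟨1 / (4 * (n + m + 1) * C), by positivity, ?_⟩
    have : ((n : ℝ) + m) * (1 / (4 * (n + m + 1) * C)) * C = (n + m) / (4 * (n + m + 1)) := by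
      field_simp
    rw [this, div_lt_div_iff₀ (by positivity) (by norm_num)]
    have : (0 : ℝ) ≤ n + m := by positivity
    linarith
  obtain ⟨φ, hφ⟩ := exists_norm_comp_hat_lt hz hε
  obtain ⟨x, hx⟩ := exists_norm_tilde_lt hw hε
  have hφ0 : 0 < ‖φ‖ := pos_of_mul_pos_right ((norm_nonneg _).trans_lt hφ) hε.le
  have hx0 : 0 < ‖x‖ := pos_of_mul_pos_right ((norm_nonneg _).trans_lt hx) hε.le
  obtain ⟨y, hy⟩ : ∃ y, 1 / 2 * ‖φ‖ * ‖y‖ < ‖φ y‖ := by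
    by_contra! h
    have := φ.opNorm_le_bound (by positivity) h
    linarith
  obtain ⟨u, hu, hux⟩ := exists_dual_vector ℂ x hx0.ne'
  obtain ⟨A, hA, hAn⟩ := hpre (J.rankOne y u)
  rw [norm_rankOne, hu, mul_one] at hAn
  have h := J.norm_apply_hat_mulTuple_le (translate S z) (translate T w) φ x A
  rw [hA, toOp_rankOne, ContinuousLinearMap.smulRight_apply, hux, map_smul, norm_smul,
    RCLike.norm_ofReal, abs_norm] at h
  have h1 : (n * (‖φ.comp (hat (translate S z))‖ * ‖x‖) +
      m * (‖φ‖ * ‖tilde (translate T w) x‖)) * ‖A‖ ≤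
      (n * ((ε * ‖φ‖) * ‖x‖) + m * (‖φ‖ * (ε * ‖x‖))) * (C * ‖y‖) := by
    gcongr
  have h2 : (n * ((ε * ‖φ‖) * ‖x‖) + m * (‖φ‖ * (ε * ‖x‖))) * (C * ‖y‖) ≤
      1 / 2 * (‖x‖ * (‖φ‖ * ‖y‖)) := by
    calc _ = ((n + m) * ε * C) * (‖x‖ * (‖φ‖ * ‖y‖)) := by ring
      _ ≤ _ := by gcongr
  have h3 := mul_lt_mul_of_pos_left hy hx0
  linarith

/-- Each multiplication sends `x ⊗ φ` to `Sᵢ x ⊗ φ` or `x ⊗ (φ ∘ Tⱼ)` (translated tuples), and the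
cross norm property makes both small. -/
theorem prodSet_subset_approxPointSpectrum_mulTuple [CompleteSpace X₁] [CompleteSpace X₂]
    [CompleteSpace J.Space] (S : Fin n → X₁ →L[ℂ] X₁) (T : Fin m → X₂ →L[ℂ] X₂) :
    prodSet (approxPointSpectrum S) (defectSpectrum T) ⊆
      approxPointSpectrum (J.mulTuple S T) := by
  rintro _ ⟨z, hz, w, hw, rfl⟩
  by_contra hcon
  rw [notMem_approxPointSpectrum_iff, translate_mulTuple] at hcon
  obtain ⟨c, hc, h⟩ := hcon
  obtain ⟨x, hx⟩ := exists_norm_tilde_lt hz hc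
  obtain ⟨φ, hφ⟩ := exists_norm_comp_hat_lt hw hc
  have hφ0 : 0 < ‖φ‖ := pos_of_mul_pos_right ((norm_nonneg _).trans_lt hφ) hc.le
  have hx0 : 0 < ‖x‖ := pos_of_mul_pos_right ((norm_nonneg _).trans_lt hx) hc.le
  refine absurd (h (J.rankOne x φ)) (not_le.2 ?_)
  rw [norm_rankOne, pi_norm_lt_iff (by positivity)]
  refine Fin.addCases (fun i => ?_) (fun j => ?_)
  · rw [tilde_apply, mulTuple, Fin.append_left, leftMul_rankOne, norm_rankOne, ← mul_assoc]
    gcongr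
    exact (norm_le_pi_norm (tilde (translate S z) x) i).trans_lt hx
  · rw [tilde_apply, mulTuple, Fin.append_right, rightMul_rankOne, norm_rankOne, mul_left_comm]
    gcongr
    exact (norm_comp_le_norm_comp_hat _ φ j).trans_lt hφ

end OperatorIdeal

end JointSpectra

end

theorem proposition6p1 {X₁ X₂ : Type*}
    [NormedAddCommGroup X₁] [NormedSpace ℂ X₁] [CompleteSpace X₁]
    [NormedAddCommGroup X₂] [NormedSpace ℂ X₂] [CompleteSpace X₂]
    (J : JointSpectra.OperatorIdeal X₂ X₁) [CompleteSpace J.Space]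
    {n m : ℕ} (S : Fin n → X₁ →L[ℂ] X₁) (T : Fin m → X₂ →L[ℂ] X₂)
    (hS : ∀ i j, Commute (S i) (S j)) (hT : ∀ i j, Commute (T i) (T j)) :
    (JointSpectra.prodSet (JointSpectra.defectSpectrum S) (JointSpectra.approxPointSpectrum T) ⊆
        JointSpectra.defectSpectrum (J.mulTuple S T) ∧
      JointSpectra.defectSpectrum (J.mulTuple S T) ⊆
        JointSpectra.splitDefectSpectrum (J.mulTuple S T) ∧
      JointSpectra.splitDefectSpectrum (J.mulTuple S T) ⊆
        JointSpectra.prodSet (JointSpectra.splitDefectSpectrum S)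
          (JointSpectra.splitApproxPointSpectrum T)) ∧
    (JointSpectra.prodSet (JointSpectra.approxPointSpectrum S) (JointSpectra.defectSpectrum T) ⊆
        JointSpectra.approxPointSpectrum (J.mulTuple S T) ∧
      JointSpectra.approxPointSpectrum (J.mulTuple S T) ⊆
        JointSpectra.splitApproxPointSpectrum (J.mulTuple S T) ∧
      JointSpectra.splitApproxPointSpectrum (J.mulTuple S T) ⊆
        JointSpectra.prodSet (JointSpectra.splitApproxPointSpectrum S)
          (JointSpectra.splitDefectSpectrum T)) ∧
    (JointSpectra.IsHilbert X₁ → JointSpectra.IsHilbert X₂ →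
      (JointSpectra.prodSet (JointSpectra.defectSpectrum S) (JointSpectra.approxPointSpectrum T) =
          JointSpectra.defectSpectrum (J.mulTuple S T) ∧
        JointSpectra.defectSpectrum (J.mulTuple S T) =
          JointSpectra.splitDefectSpectrum (J.mulTuple S T) ∧
        JointSpectra.splitDefectSpectrum (J.mulTuple S T) =
          JointSpectra.prodSet (JointSpectra.splitDefectSpectrum S)
            (JointSpectra.splitApproxPointSpectrum T)) ∧
      (JointSpectra.prodSet (JointSpectra.approxPointSpectrum S) (JointSpectra.defectSpectrum T) =
          JointSpectra.approxPointSpectrum (J.mulTuple S T) ∧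
        JointSpectra.approxPointSpectrum (J.mulTuple S T) =
          JointSpectra.splitApproxPointSpectrum (J.mulTuple S T) ∧
        JointSpectra.splitApproxPointSpectrum (J.mulTuple S T) =
          JointSpectra.prodSet (JointSpectra.splitApproxPointSpectrum S)
            (JointSpectra.splitDefectSpectrum T))) := by
  have hi₁ := J.prodSet_subset_defectSpectrum_mulTuple S T
  have hi₂ : JointSpectra.defectSpectrum (J.mulTuple S T) ⊆
    JointSpectra.splitDefectSpectrum (J.mulTuple S T) := Set.subset_union_left
  have hi₃ := J.splitDefectSpectrum_mulTuple_subset S T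
  have hii₁ := J.prodSet_subset_approxPointSpectrum_mulTuple S T
  have hii₂ : JointSpectra.approxPointSpectrum (J.mulTuple S T) ⊆
    JointSpectra.splitApproxPointSpectrum (J.mulTuple S T) := Set.subset_union_left
  have hii₃ := J.splitApproxPointSpectrum_mulTuple_subset S T
  refine ⟨⟨hi₁, hi₂, hi₃⟩, ⟨hii₁, hii₂, hii₃⟩, fun hX₁ hX₂ => ?_⟩
  rw [hX₁.splitDefectSpectrum_eq, hX₂.splitApproxPointSpectrum_eq] at hi₃ ⊢
  rw [hX₁.splitApproxPointSpectrum_eq, hX₂.splitDefectSpectrum_eq] at hii₃ ⊢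
  exact ⟨⟨hi₁.antisymm (hi₂.trans hi₃), hi₂.antisymm (hi₃.trans hi₁),
      hi₃.antisymm (hi₁.trans hi₂)⟩,
    ⟨hii₁.antisymm (hii₂.trans hii₃), hii₂.antisymm (hii₃.trans hii₁),
      hii₃.antisymm (hii₁.trans hii₂)⟩⟩
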